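/- Let $(M,d)$ be a complete metric space with a distinguished base point $0\in M$. Let $\mathrm{Lip}_0(M)$ be the Banach space of Lipschitz functions $g:M\to\mathbb C$ with $g(0)=0$, with norm $\|g\|_L=\sup_{x\neq y}\frac{|g(x)-g(y)|}{d(x,y)}$; for $x\in M$ let $\delta(x)\in\mathrm{Lip}_0(M)^*$ be the evaluation functional $g\mapsto g(x)$, and let $\mathcal F(M)=\overline{\mathrm{span}}\{\delta(x):x\in M\}\subset\mathrm{Lip}_0(M)^*$ be the (complex) Lipschitz-free space over $M$. For $\gamma\in\mathcal F(M)$, the support $\mathrm{supp}(\gamma)$ is the smallest closed set $N\subset M$ with $\gamma\in\overline{\mathrm{span}}\{\delta(x):x\in N\}$, that is, the intersection of all closed sets $N$ with this property. Let $f:M\to M$ be a Lipschitz map with $f(0)=0$, and let $\widehat f:\mathcal F(M)\to\mathcal F(M)$ be the unique bounded linear operator with $\widehat f(\delta(x))=\delta(f(x))$ for all $x\in M$. Suppose that $f$ is flat at infinity, i.e. $$\lim_{\substack{d(x,0)\to\infty\\ d(y,0)\to\infty}}\frac{d(f(x),f(y))}{d(x,y)}=0\qquad (x\neq y).$$ If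 $\widehat f(\gamma)=\lambda\gamma$ for some $\lambda\in\mathbb C\setminus\{0\}$ and some $\gamma\in\mathcal F(M)\setminus\{0\}$, then $\mathrm{supp}(\gamma)$ is bounded. -/

import Mathlib

noncomputable section

namespace LipFree

open Filter Topology

variable {M : Type*} [MetricSpace M]

/-- The complex-valued Lipschitz functions on `M` that vanish at the base point `o`, as a linear
subspace of `M → ℂ`. -/
def lipSubmodule (o : M) : Submodule ℂ (M → ℂ) where
  carrier := {g | (∃ K, LipschitzWith K g) ∧ g o = 0}
  zero_mem' := ⟨⟨0, LipschitzWith.const 0⟩, rfl⟩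
  add_mem' := by
    rintro a b ⟨⟨K, hK⟩, ha⟩ ⟨⟨L, hL⟩, hb⟩
    exact ⟨⟨K + L, hK.add hL⟩, by simp [ha, hb]⟩
  smul_mem' := by
    rintro c a ⟨⟨K, hK⟩, ha⟩
    exact ⟨⟨‖c‖₊ * K, (lipschitzWith_smul c).comp hK⟩, by simp [ha]⟩

/-- The space `Lip₀(M)`. A separate type, so that its only topology is the one of the Lipschitz
norm below. -/
def Lip0 (o : M) : Type _ := lipSubmodule o

instance (o : M) : AddCommGroup (Lip0 o) := inferInstanceAs (AddCommGroup (lipSubmodule o))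

instance (o : M) : Module ℂ (Lip0 o) := inferInstanceAs (Module ℂ (lipSubmodule o))

instance (o : M) : CoeFun (Lip0 o) (fun _ => M → ℂ) := ⟨fun g => g.1⟩

section Lip0

variable {o : M}

theorem Lip0.map_base (g : Lip0 o) : g o = 0 := g.2.2

@[simp] theorem Lip0.add_apply (g h : Lip0 o) (x : M) : (g + h) x = g x + h x := rfl

@[simp] theorem Lip0.smul_apply (c : ℂ) (g : Lip0 o) (x : M) : (c • g) x = c * g x := rfl

/-- The Lipschitz norm `sup_{x ≠ y} |g x - g y| / d(x, y)`; the pairs with `x = y` contribute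
`0 / 0 = 0`. -/
instance (o : M) : Norm (Lip0 o) := ⟨fun g => ⨆ p : M × M, ‖g p.1 - g p.2‖ / dist p.1 p.2⟩

theorem Lip0.norm_def (g : Lip0 o) : ‖g‖ = ⨆ p : M × M, ‖g p.1 - g p.2‖ / dist p.1 p.2 := rfl

theorem Lip0.norm_nonneg' (g : Lip0 o) : 0 ≤ ‖g‖ :=
  Real.iSup_nonneg fun _ => by positivity

theorem Lip0.norm_sub_le (g : Lip0 o) (x y : M) : ‖g x - g y‖ ≤ ‖g‖ * dist x y := by
  obtain ⟨K, hK⟩ := g.2.1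
  have hb : BddAbove (Set.range fun p : M × M => ‖g p.1 - g p.2‖ / dist p.1 p.2) := by
    refine ⟨K, ?_⟩
    rintro _ ⟨p, rfl⟩
    refine div_le_of_le_mul₀ dist_nonneg K.2 ?_
    have := hK.dist_le_mul p.1 p.2
    rwa [dist_eq_norm] at this
  rcases eq_or_ne x y with rfl | hxy
  · simp
  · exact (div_le_iff₀ (dist_pos.2 hxy)).1 (le_ciSup hb (x, y))

theorem Lip0.norm_le (g : Lip0 o) {C : ℝ} (hC : 0 ≤ C)
    (h : ∀ x y, ‖g x - g y‖ ≤ C * dist x y) : ‖g‖ ≤ C :=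
  Real.iSup_le (fun p => div_le_of_le_mul₀ dist_nonneg hC (h p.1 p.2)) hC

theorem Lip0.norm_apply_le (g : Lip0 o) (x : M) : ‖g x‖ ≤ ‖g‖ * dist x o := by
  have := g.norm_sub_le x o
  rwa [g.map_base, sub_zero] at this

theorem Lip0.normCore (o : M) : NormedSpace.Core ℂ (Lip0 o) where
  norm_nonneg := Lip0.norm_nonneg'
  norm_smul c g := by
    rw [Lip0.norm_def, Lip0.norm_def, ← smul_eq_mul, Real.smul_iSup_of_nonneg (norm_nonneg c)]
    congr 1
    funext p
    rw [Lip0.smul_apply, Lip0.smul_apply, ← mul_sub, norm_mul, mul_div_assoc, smul_eq_mul]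
  norm_triangle g h := by
    refine Lip0.norm_le _ (add_nonneg g.norm_nonneg' h.norm_nonneg') fun x y => ?_
    have e : (g + h) x - (g + h) y = (g x - g y) + (h x - h y) := by simp; ring
    rw [e, add_mul]
    exact (norm_add_le _ _).trans (add_le_add (g.norm_sub_le x y) (h.norm_sub_le x y))
  norm_eq_zero_iff g := by
    refine ⟨fun h => ?_, ?_⟩
    · refine Subtype.ext (funext fun x => ?_)
      have := g.norm_apply_le x
      rw [h, zero_mul] at this
      exact norm_le_zero_iff.1 this
    · rintro rfl
      refine le_antisymm (Lip0.norm_le _ le_rfl fun x y => ?_) (Lip0.norm_nonneg' _)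
      have e : ∀ z, (0 : Lip0 o) z = 0 := fun _ => rfl
      simp [e]

end Lip0

instance (o : M) : NormedAddCommGroup (Lip0 o) := NormedAddCommGroup.ofCore (Lip0.normCore o)

instance (o : M) : NormedSpace ℂ (Lip0 o) := NormedSpace.ofCore (Lip0.normCore o)

/-- The evaluation functional at `x`, as an element of the dual of `Lip₀(M)`. -/
def evalAt (o x : M) : StrongDual ℂ (Lip0 o) :=
  LinearMap.mkContinuous
    { toFun := fun g => g x
      map_add' := fun _ _ => rfl
      map_smul' := fun _ _ => rfl }
    (dist x o) (fun g => by
      rw [mul_comm]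
      exact g.norm_apply_le x)

@[simp] theorem evalAt_apply (o x : M) (g : Lip0 o) : evalAt o x g = g x := rfl

/-- The Lipschitz-free space `F(M)`: the closed linear span of the evaluation functionals in the
dual of `Lip₀(M)`. -/
def freeSpace (o : M) : Submodule ℂ (StrongDual ℂ (Lip0 o)) :=
  (Submodule.span ℂ (Set.range (evalAt o))).topologicalClosure

/-- The canonical map `δ : M → F(M)`. -/
def delta (o x : M) : freeSpace o :=
  ⟨evalAt o x, Submodule.le_topologicalClosure _ (Submodule.subset_span ⟨x, rfl⟩)⟩

/-- The composition operator `g ↦ g ∘ f` on `Lip₀(M)`, for a base point preserving Lipschitz map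
`f`. -/
def compOp (o : M) (f : M → M) (hf : ∃ K, LipschitzWith K f) (ho : f o = o) :
    Lip0 o →L[ℂ] Lip0 o :=
  LinearMap.mkContinuousOfExistsBound
    { toFun := fun g => ⟨fun x => g (f x), by
        obtain ⟨K, hK⟩ := hf
        obtain ⟨L, hL⟩ := g.2.1
        exact ⟨⟨L * K, hL.comp hK⟩, by simp only [ho]; exact g.map_base⟩⟩
      map_add' := fun _ _ => rfl
      map_smul' := fun _ _ => rfl }
    (by
      obtain ⟨K, hK⟩ := hf
      refine ⟨K, fun g => Lip0.norm_le _ (mul_nonneg K.2 (norm_nonneg g)) fun x y => ?_⟩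
      refine (g.norm_sub_le (f x) (f y)).trans ?_
      rw [mul_comm (K : ℝ), mul_assoc]
      exact mul_le_mul_of_nonneg_left (hK.dist_le_mul x y) (norm_nonneg g))

@[simp] theorem compOp_apply (o : M) (f : M → M) (hf : ∃ K, LipschitzWith K f) (ho : f o = o)
    (g : Lip0 o) (x : M) : compOp o f hf ho g x = g (f x) := rfl

/-- The transpose `φ ↦ φ ∘ C_f` of the composition operator, on the dual of `Lip₀(M)`. -/
def dualOp (o : M) (f : M → M) (hf : ∃ K, LipschitzWith K f) (ho : f o = o) :
    StrongDual ℂ (Lip0 o) →L[ℂ] StrongDual ℂ (Lip0 o) :=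
  (ContinuousLinearMap.compL ℂ (Lip0 o) (Lip0 o) ℂ).flip (compOp o f hf ho)

theorem dualOp_evalAt (o : M) (f : M → M) (hf : ∃ K, LipschitzWith K f) (ho : f o = o) (x : M) :
    dualOp o f hf ho (evalAt o x) = evalAt o (f x) := rfl

theorem dualOp_mem (o : M) (f : M → M) (hf : ∃ K, LipschitzWith K f) (ho : f o = o)
    (γ : StrongDual ℂ (Lip0 o)) (hγ : γ ∈ freeSpace o) : dualOp o f hf ho γ ∈ freeSpace o := by
  have h1 : Submodule.span ℂ (Set.range (evalAt o)) ≤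
      (freeSpace o).comap (dualOp o f hf ho : _ →ₗ[ℂ] _) := by
    rw [Submodule.span_le]
    rintro _ ⟨x, rfl⟩
    exact (delta o (f x)).2
  have hc : IsClosed (((freeSpace o).comap (dualOp o f hf ho : _ →ₗ[ℂ] _) :
      Submodule ℂ (StrongDual ℂ (Lip0 o))) : Set (StrongDual ℂ (Lip0 o))) :=
    (Submodule.isClosed_topologicalClosure _).preimage (dualOp o f hf ho).continuous
  exact Submodule.topologicalClosure_minimal _ h1 hc hγ

/-- The Lipschitz operator `f̂ : F(M) → F(M)`, i.e. the unique bounded linear operator with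
`f̂ (δ x) = δ (f x)`. -/
def lipOp (o : M) (f : M → M) (hf : ∃ K, LipschitzWith K f) (ho : f o = o) :
    freeSpace o →L[ℂ] freeSpace o :=
  ((dualOp o f hf ho).comp (freeSpace o).subtypeL).codRestrict (freeSpace o)
    (fun γ => dualOp_mem o f hf ho γ γ.2)

theorem lipOp_delta (o : M) (f : M → M) (hf : ∃ K, LipschitzWith K f) (ho : f o = o) (x : M) :
    lipOp o f hf ho (delta o x) = delta o (f x) := rfl

instance (o : M) : ContinuousAdd (freeSpace o) :=
  (inferInstance : IsTopologicalAddGroup (freeSpace o)).toContinuousAdd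

/-- `F_M(N)`: the closed linear span of `δ(N)` in `F(M)`. -/
def freeSub (o : M) (N : Set M) : Submodule ℂ (freeSpace o) :=
  (Submodule.span ℂ (delta o '' N)).topologicalClosure

/-- The support of `γ ∈ F(M)`: the smallest closed `N ⊆ M` with `γ ∈ F_M(N)`, i.e. the
intersection of all closed sets with this property. -/
def supp (o : M) (γ : freeSpace o) : Set M :=
  ⋂₀ {N : Set M | IsClosed N ∧ γ ∈ freeSub o N}

/-- `f` is flat at infinity: `d(f x, f y) / d(x, y) → 0` as `d(x, o) → ∞` and `d(y, o) → ∞`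
(pairs with `x = y` give `0 / 0 = 0`). -/
def FlatAtInfinity (o : M) (f : M → M) : Prop :=
  Tendsto (fun p : M × M => dist (f p.1) (f p.2) / dist p.1 p.2)
    (comap (fun x => dist x o) atTop ×ˢ comap (fun x => dist x o) atTop) (𝓝 0)

end LipFree

end

namespace LipFree

open Filter Topology

/-! Work with the composition operator `g ↦ g ∘ f` on `Lip0 o`, to which `lipOp` is adjoint.
Flatness makes it preserve the functions vanishing on some large ball and shrink their norms by `‖c‖
/ 2` (`exists_closedBall_norm_compOp_le`). Since `γ (g ∘ f) = c * γ g`, iteration gives `‖γ g‖ ≤ 2⁻ⁿ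
‖γ‖ ‖g‖` for such `g`, so `γ g = 0` (`apply_eq_zero_of_norm_compOp_le`). By Hahn–Banach `γ` lies in
the closed span of `δ` of the ball (`mem_freeSub_of_forall_apply_eq_zero`), and the ball then
contains the support, an intersection of such closed sets. -/

theorem exists_dual_ne_zero_of_notMem {E : Type*} [NormedAddCommGroup E] [NormedSpace ℂ E]
    {S : Submodule ℂ E} (hS : IsClosed (S : Set E)) {x : E} (hx : x ∉ S) :
    ∃ ψ : StrongDual ℂ E, ψ x ≠ 0 ∧ ∀ y ∈ S, ψ y = 0 := by
  have : IsClosed (S.toAddSubgroup : Set E) := hS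
  let _ : NormedAddCommGroup (E ⧸ S) := Submodule.Quotient.normedAddCommGroup S
  obtain ⟨φ, hφ⟩ := SeparatingDual.exists_ne_zero (R := ℂ)
    (mt (Submodule.Quotient.mk_eq_zero S).1 hx)
  refine ⟨φ.comp S.mkQL, hφ, fun y hy => ?_⟩
  change φ (Submodule.Quotient.mk y) = 0
  rw [(Submodule.Quotient.mk_eq_zero S).2 hy, map_zero]

/-- The Lipschitz function `x ↦ ψ (δ x)` induced by a continuous functional `ψ` on the dual
of `Lip₀(M)`. -/
noncomputable def toLip0 {M : Type*} [MetricSpace M] {o : M}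
    (ψ : StrongDual ℂ (StrongDual ℂ (Lip0 o))) : Lip0 o :=
  ⟨fun x => ψ (evalAt o x), by
    have hbase : evalAt o o = 0 := ContinuousLinearMap.ext fun g => g.map_base
    refine ⟨⟨‖ψ‖₊, LipschitzWith.of_dist_le_mul fun x y => ?_⟩, by simp [hbase]⟩
    rw [dist_eq_norm, ← map_sub]
    -- The constant `‖ψ‖` works because `‖δ x - δ y‖ ≤ d(x, y)`.
    refine (ψ.le_opNorm _).trans (mul_le_mul_of_nonneg_left ?_ (norm_nonneg ψ))
    refine ContinuousLinearMap.opNorm_le_bound _ dist_nonneg fun g => ?_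
    rw [mul_comm]
    exact g.norm_sub_le x y⟩

/-- On the Lipschitz-free space, every functional is the evaluation at a Lipschitz function. -/
theorem apply_toLip0 {M : Type*} [MetricSpace M] {o : M}
    (ψ : StrongDual ℂ (StrongDual ℂ (Lip0 o))) (γ : freeSpace o) : γ.1 (toLip0 ψ) = ψ γ.1 := by
  have h : freeSpace o ≤ (ContinuousLinearMap.apply ℂ ℂ (toLip0 ψ) - ψ).ker := by
    refine Submodule.topologicalClosure_minimal _ (Submodule.span_le.2 ?_)
      (ContinuousLinearMap.isClosed_ker _)
    rintro _ ⟨x, rfl⟩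
    exact sub_self (ψ (evalAt o x))
  exact sub_eq_zero.1 (h γ.2)

/-- Closure in a subspace is the trace of the ambient closure. This lets separation take place in
the full dual of `Lip0 o`. -/
theorem mem_freeSub_iff {M : Type*} [MetricSpace M] {o : M} {N : Set M} {γ : freeSpace o} :
    γ ∈ freeSub o N ↔ γ.1 ∈ (Submodule.span ℂ (evalAt o '' N)).topologicalClosure := by
  have himage : (Submodule.span ℂ (delta o '' N)).map (freeSpace o).subtype =
      Submodule.span ℂ (evalAt o '' N) := by
    rw [Submodule.map_span, ← Set.image_comp]
    rfl
  rw [← himage, freeSub, ← SetLike.mem_coe, ← SetLike.mem_coe, Submodule.topologicalClosure_coe,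
    Submodule.topologicalClosure_coe, closure_subtype]
  rfl

/-- A functional separating `γ` from the closed span of `δ(N)` acts on `γ` as a Lipschitz function,
and that function vanishes on `N`. -/
theorem mem_freeSub_of_forall_apply_eq_zero {M : Type*} [MetricSpace M] {o : M} {N : Set M}
    {γ : freeSpace o} (h : ∀ g : Lip0 o, (∀ x ∈ N, g x = 0) → γ.1 g = 0) : γ ∈ freeSub o N := by
  rw [mem_freeSub_iff]
  by_contra hγ
  obtain ⟨ψ, hψγ, hψ⟩ :=
    exists_dual_ne_zero_of_notMem (Submodule.isClosed_topologicalClosure _) hγ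
  refine hψγ ((apply_toLip0 ψ γ).symm.trans (h _ fun x hx => ?_))
  exact hψ _ (Submodule.le_topologicalClosure _ (Submodule.subset_span ⟨x, hx, rfl⟩))

/-- Away from a large ball, a map that is flat at infinity has small Lipschitz constant. -/
theorem FlatAtInfinity.exists_radius {M : Type*} [MetricSpace M] {o : M} {f : M → M}
    (hflat : FlatAtInfinity o f) {ε : ℝ} (hε : 0 < ε) :
    ∃ R : ℝ, 0 ≤ R ∧ ∀ x y, R ≤ dist x o → R ≤ dist y o → dist (f x) (f y) ≤ ε * dist x y := by
  have hb : (comap (fun x : M => dist x o) atTop).HasBasis (fun _ : ℝ => True)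
      fun R => {x | R ≤ dist x o} := atTop_basis.comap _
  obtain ⟨⟨R, S⟩, -, hRS⟩ := (hb.prod hb).eventually_iff.1 (hflat.eventually_lt_const hε)
  refine ⟨max 0 (max R S), le_max_left _ _, fun x y hx hy => ?_⟩
  rcases eq_or_ne x y with rfl | hxy
  · simp
  have h := @hRS (x, y) ⟨((le_max_left R S).trans (le_max_right 0 _)).trans hx,
    ((le_max_right R S).trans (le_max_right 0 _)).trans hy⟩
  exact ((div_lt_iff₀ (dist_pos.2 hxy)).1 h).le

/-- Comparison with one fixed far point `z` turns the small Lipschitz constant at infinity into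
small linear growth. -/
theorem exists_dist_le_mul_add {M : Type*} [MetricSpace M] {o : M} {f : M → M}
    (hf : ∃ K, LipschitzWith K f) (ho : f o = o) {ε R : ℝ} (hε : 0 ≤ ε) (hR : 0 ≤ R)
    (h : ∀ x y, R ≤ dist x o → R ≤ dist y o → dist (f x) (f y) ≤ ε * dist x y) :
    ∃ D, ∀ x, dist (f x) o ≤ ε * dist x o + D := by
  obtain ⟨K, hK⟩ := hf
  have hlip : ∀ x, dist (f x) o ≤ K * dist x o := fun x => by
    simpa only [ho] using hK.dist_le_mul x o
  have hK0 : (0 : ℝ) ≤ K := K.2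
  by_cases hz : ∃ z, R ≤ dist z o
  · obtain ⟨z, hz⟩ := hz
    -- `K * R` covers the points within `R` of `o`; the rest pays for the detour through `z` and `f
    -- z`.
    refine ⟨K * R + (ε + K) * dist z o, fun x => ?_⟩
    have hz0 : 0 ≤ dist z o := dist_nonneg
    rcases le_total R (dist x o) with hx | hx
    · have h1 := dist_triangle (f x) (f z) o
      have h2 := mul_le_mul_of_nonneg_left (dist_triangle_right x z o) hε
      nlinarith [h x z hx hz, hlip z, mul_nonneg hK0 hR]
    · nlinarith [hlip x, mul_le_mul_of_nonneg_left hx hK0, mul_nonneg hε hz0, mul_nonneg hK0 hz0,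
        mul_nonneg hε (dist_nonneg (x := x) (y := o))]
  · push Not at hz
    refine ⟨K * R, fun x => ?_⟩
    nlinarith [hlip x, mul_le_mul_of_nonneg_left (hz x).le hK0,
      mul_nonneg hε (dist_nonneg (x := x) (y := o))]

/-- If `f` is flat at infinity, composition with `f` preserves the functions vanishing on a large
ball and contracts their norm by an arbitrarily small factor. -/
theorem exists_closedBall_norm_compOp_le {M : Type*} [MetricSpace M] {o : M} {f : M → M}
    (hf : ∃ K, LipschitzWith K f) (ho : f o = o) (hflat : FlatAtInfinity o f) {q : ℝ}
    (hq : 0 < q) :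
    ∃ r : ℝ, ∀ g : Lip0 o, (∀ x ∈ Metric.closedBall o r, g x = 0) →
      (∀ x ∈ Metric.closedBall o r, compOp o f hf ho g x = 0) ∧
        ‖compOp o f hf ho g‖ ≤ q * ‖g‖ := by
  -- `2 * ε ≤ 1` keeps the ball invariant. In `4 * ε ≤ q`, one factor 2 comes from `hgrow`, the
  -- other from `hxy`.
  obtain ⟨ε, hε, hε2, hεq⟩ : ∃ ε : ℝ, 0 < ε ∧ 2 * ε ≤ 1 ∧ 4 * ε ≤ q :=
    ⟨min (1 / 2) (q / 4), by positivity, by linarith [min_le_left (1 / 2) (q / 4)],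
      by linarith [min_le_right (1 / 2) (q / 4)]⟩
  obtain ⟨R, hR, hflatR⟩ := hflat.exists_radius hε
  obtain ⟨D, hD⟩ := exists_dist_le_mul_add hf ho hε.le hR hflatR
  -- `D ≤ ε * r` absorbs the additive constant; `2 * R ≤ r` separates the `R`-ball from the outside
  -- of the `r`-ball.
  obtain ⟨r, hrR, hrD⟩ : ∃ r : ℝ, 2 * R ≤ r ∧ D ≤ ε * r := by
    refine ⟨max (2 * R) (D / ε), le_max_left _ _, ?_⟩
    have := (div_le_iff₀ hε).1 (le_max_right (2 * R) (D / ε))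
    linarith
  have hgrow : ∀ y, r ≤ dist y o → dist (f y) o ≤ 2 * ε * dist y o := fun y hy => by
    nlinarith [hD y]
  refine ⟨r, fun g hg => ?_⟩
  have hvan : ∀ x, dist x o ≤ r → g (f x) = 0 := fun x hx => by
    refine hg _ (Metric.mem_closedBall.2 ?_)
    nlinarith [hD x]
  have hg0 := norm_nonneg g
  have key : ∀ x y, r ≤ dist y o → ‖g (f x) - g (f y)‖ ≤ q * ‖g‖ * dist x y := by
    intro x y hy
    rcases le_total R (dist x o) with hx | hx
    · refine (g.norm_sub_le _ _).trans ?_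
      have h := hflatR x y hx (by linarith)
      calc ‖g‖ * dist (f x) (f y) ≤ ‖g‖ * (q * dist x y) := by
            refine mul_le_mul_of_nonneg_left (h.trans ?_) hg0
            exact mul_le_mul_of_nonneg_right (by linarith) dist_nonneg
        _ = q * ‖g‖ * dist x y := by ring
    · rw [hvan x (by linarith), zero_sub, norm_neg]
      refine (g.norm_apply_le _).trans ?_
      -- Here `d(x, o) ≤ R ≤ r / 2 ≤ d(y, o) / 2`.
      have hxy : dist y o ≤ 2 * dist x y := by
        linarith [dist_triangle_left y o x]
      calc ‖g‖ * dist (f y) o ≤ ‖g‖ * (q * dist x y) := by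
            refine mul_le_mul_of_nonneg_left ?_ hg0
            have h1 := mul_le_mul_of_nonneg_left hxy (by linarith : 0 ≤ 2 * ε)
            have h2 := mul_le_mul_of_nonneg_right hεq (dist_nonneg (x := x) (y := y))
            linarith [hgrow y hy]
        _ = q * ‖g‖ * dist x y := by ring
  refine ⟨fun x hx => hvan x hx, Lip0.norm_le _ (by positivity) fun x y => ?_⟩
  simp only [compOp_apply]
  rcases le_total r (dist y o) with hy | hy
  · exact key x y hy
  rcases le_total r (dist x o) with hx | hx
  · rw [norm_sub_rev, dist_comm]
    exact key y x hx
  · rw [hvan x hx, hvan y hy, sub_zero, norm_zero]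
    positivity

/-- An eigenvector of `f̂` annihilates every subset of `Lip₀(M)` that is invariant under composition
with `f` and on which this composition is a contraction relative to the eigenvalue. -/
theorem apply_eq_zero_of_norm_compOp_le {M : Type*} [MetricSpace M] {o : M} {f : M → M}
    {hf : ∃ K, LipschitzWith K f} {ho : f o = o} {γ : freeSpace o} {c : ℂ} (hc : c ≠ 0)
    (heig : lipOp o f hf ho γ = c • γ) {W : Set (Lip0 o)}
    (hW : ∀ g ∈ W, compOp o f hf ho g ∈ W ∧ ‖compOp o f hf ho g‖ ≤ ‖c‖ / 2 * ‖g‖)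
    {g : Lip0 o} (hg : g ∈ W) : γ.1 g = 0 := by
  have hc0 : 0 < ‖c‖ := norm_pos_iff.2 hc
  have hcomp : ∀ g, γ.1 (compOp o f hf ho g) = c * γ.1 g := fun g =>
    DFunLike.congr_fun (congrArg Subtype.val heig) g
  have hbound : ∀ n : ℕ, ∀ g ∈ W, ‖γ.1 g‖ ≤ (1 / 2 : ℝ) ^ n * (‖γ.1‖ * ‖g‖) := by
    intro n
    induction n with
    | zero => intro g _; simpa using γ.1.le_opNorm g
    | succ n ih =>
      intro g hg
      obtain ⟨hCg, hle⟩ := hW g hg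
      -- The eigenvalue equation pulls out a factor `‖c‖`, which cancels against `‖c‖ / 2` and
      -- leaves the extra `1 / 2`.
      have h := ih _ hCg
      rw [hcomp, norm_mul] at h
      refine le_of_mul_le_mul_left (h.trans ?_) hc0
      calc (1 / 2 : ℝ) ^ n * (‖γ.1‖ * ‖compOp o f hf ho g‖)
          ≤ (1 / 2 : ℝ) ^ n * (‖γ.1‖ * (‖c‖ / 2 * ‖g‖)) := by gcongr
        _ = ‖c‖ * ((1 / 2 : ℝ) ^ (n + 1) * (‖γ.1‖ * ‖g‖)) := by ring
  have hlim : Tendsto (fun n : ℕ => (1 / 2 : ℝ) ^ n * (‖γ.1‖ * ‖g‖)) atTop (𝓝 0) := by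
    simpa using (tendsto_pow_atTop_nhds_zero_of_lt_one (by norm_num : (0 : ℝ) ≤ 1 / 2)
      (by norm_num)).mul_const (‖γ.1‖ * ‖g‖)
  exact norm_le_zero_iff.1 (ge_of_tendsto' hlim fun n => hbound n g hg)

end LipFree

theorem mainTheorem3 {M : Type*} [MetricSpace M] [CompleteSpace M] (o : M) (f : M → M)
    (hf : ∃ K, LipschitzWith K f) (ho : f o = o) (hflat : LipFree.FlatAtInfinity o f)
    (γ : LipFree.freeSpace o) (hγ : γ ≠ 0) (c : ℂ) (hc : c ≠ 0)
    (heig : LipFree.lipOp o f hf ho γ = c • γ) :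
    Bornology.IsBounded (LipFree.supp o γ) := by
  obtain ⟨r, hr⟩ := LipFree.exists_closedBall_norm_compOp_le hf ho hflat
    (half_pos (norm_pos_iff.2 hc))
  refine (Metric.isBounded_closedBall (x := o) (r := r)).subset (Set.sInter_subset_of_mem
    ⟨Metric.isClosed_closedBall, LipFree.mem_freeSub_of_forall_apply_eq_zero fun g hg => ?_⟩)
  exact LipFree.apply_eq_zero_of_norm_compOp_le hc heig
    (W := {g | ∀ x ∈ Metric.closedBall o r, g x = 0}) hr hg
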